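/- Let $\mathbb K=\mathbb R$ or $\mathbb C$. For $1\le p\le\infty$ let $p^*$ be the conjugate exponent ($\frac1p+\frac1{p^*}=1$, $\frac1\infty=0$), and let $\ell_p^n$ be $\mathbb K^n$ with the $\ell_p$-norm. Call a bilinear form $A:\ell_{p_1}^n\times\ell_{p_2}^n\to\mathbb K$ a *$\pm1$ form* if $A(x,y)=\sum_{i=1}^n\sum_{j=1}^n s_{ij}x_iy_j$ with all $s_{ij}\in\{1,-1\}$, and let $\|A\|=\sup\{|A(x,y)|:\|x\|_{p_1}\le1,\ \|y\|_{p_2}\le1\}$. Put $$B_{p_1,p_2}(n)=\max\left\{n^{1/p_2^*}\,n^{\max\{\frac12-\frac1{p_1},0\}},\ n^{1/p_1^*}\,n^{\max\{\frac12-\frac1{p_2},0\}}\right\}.$$ (a) For every $\varepsilon>0$ there is a positive integer $N$, depending only on $\varepsilon$, such that for all $p_1,p_2\in[1,\infty]$ and all integers $n>N$ there is a $\pm1$ form $A:\ell_{p_1}^n\times\ell_{p_2}^n\to\mathbb K$ with $\|A\|\le(1+\varepsilon)\,B_{p_1,p_2}(n)$. (b) Let $p_1,p_2\in[1,2]$ and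 $p=\max\{p_1,p_2\}$. Then for every $n\ge1$ we have $B_{p_1,p_2}(n)=n^{1/p^*}$, and every $\pm1$ form $A:\ell_{p_1}^n\times\ell_{p_2}^n\to\mathbb K$ satisfies $\|A\|\ge n^{1/p^*}$. Consequently the constant $1$ in (a) is optimal: $1$ is the smallest real number $C$ such that for every $\varepsilon>0$ there is a positive integer $N$ such that for every $n>N$ there is a $\pm1$ form $A:\ell_{p_1}^n\times\ell_{p_2}^n\to\mathbb K$ with $\|A\|\le(C+\varepsilon)\,B_{p_1,p_2}(n)$. -/

import Mathlib

open scoped ENNReal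

/-- A (continuous) bilinear form `A : ℓ_{p₁}^n × ℓ_{p₂}^n → 𝕜`, in curried form, has coefficients
`±1` if `A(x, y) = ∑ i, ∑ j, ± x i * y j`. -/
def IsSignBilinForm {𝕜 : Type*} [RCLike 𝕜] {p₁ p₂ : ℝ≥0∞} [Fact (1 ≤ p₁)] [Fact (1 ≤ p₂)] {n : ℕ}
    (A : PiLp p₁ (fun _ : Fin n => 𝕜) →L[𝕜] PiLp p₂ (fun _ : Fin n => 𝕜) →L[𝕜] 𝕜) : Prop :=
  ∃ s : Fin n → Fin n → 𝕜, (∀ i j, s i j = 1 ∨ s i j = -1) ∧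
    ∀ x y, A x y = ∑ i, ∑ j, s i j * x i * y j

/-- `1 / p` as a real number, with `1 / ∞ = 0` (used for `1 ≤ p ≤ ∞` only). -/
noncomputable def recip (p : ℝ≥0∞) : ℝ := (1 / p).toReal

/-- `max {n^{1/p₂*} n^{max (1/2 - 1/p₁, 0)}, n^{1/p₁*} n^{max (1/2 - 1/p₂, 0)}}`, where
`p* = p / (p - 1)`, `1* = ∞`, `∞* = 1`. -/
noncomputable def bennettBound (p₁ p₂ : ℝ≥0∞) (n : ℕ) : ℝ :=
  max ((n : ℝ) ^ recip p₂.conjExponent * (n : ℝ) ^ max (1 / 2 - recip p₁) 0)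
    ((n : ℝ) ^ recip p₁.conjExponent * (n : ℝ) ^ max (1 / 2 - recip p₂) 0)

/-! The form is the `n × n` corner of a Hadamard matrix of order `m`, where `n ≤ m ≤ (1 + ε) n`.
Such an `m` exists for all large `n` because Hadamard orders are closed under multiplication and
include 2 and 12. As `log 2 / log 12` is irrational, the numbers `2 ^ i * 12 ^ j` eventually have
arbitrarily small relative gaps (`exists_isHadamardOrder_near`).

Orthogonality of the rows bounds the corner by `√m` on `ℓ₂ × ℓ₂`, and unimodular entries bound it by
1 on `ℓ₁ × ℓ₁`. The three lines theorem gives `m ^ (1 - 1/p)` on `ℓ_p × ℓ_p` for `1 ≤ p ≤ 2`.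
Inclusions between `ℓ_p` spaces transfer this to all pairs `p₁, p₂`: through `ℓ_p` with `p = max p₁
p₂` if both are at most 2, otherwise through `ℓ₂`. Only powers of `m` with exponent in `[0, 1]`
occur, so replacing `m` by `n` costs at most `1 + ε`, uniformly in `p₁, p₂`.

For the lower bound, a form is tested on a basis vector and the matching row or column of signs. -/

/-! ### Nonnegative combinations of two incommensurable numbers -/

/-- Nonnegative integer combinations of `a` and `b` eventually meet every interval whose length is
a positive value `u * a - v * b`. -/
theorem exists_natCombination_mem_Icc {a b : ℝ} (ha : 0 < a) {u v : ℕ}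
    (hs : 0 < u * a - v * b) :
    ∃ T : ℝ, ∀ t : ℝ, T ≤ t → ∃ i j : ℕ, t ≤ i * a + j * b ∧
      i * a + j * b ≤ t + (u * a - v * b) := by
  set s := u * a - v * b with hs_def
  obtain ⟨M, hM⟩ := exists_nat_ge (a / s)
  rw [div_le_iff₀ hs] at hM
  -- Keep `M * v` copies of `b` in stock. Trading `v` of them for `u` copies of `a` gains `s`, and
  -- `M` trades gain at least `a`, enough to cover the remainder `r < a`.
  refine ⟨M * v * b, fun t ht => ?_⟩
  set k := ⌊(t - M * v * b) / a⌋₊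
  have hk1 : k * a ≤ t - M * v * b :=
    (le_div_iff₀ ha).1 (Nat.floor_le (div_nonneg (by linarith) ha.le))
  have hk2 : t - M * v * b < (k + 1) * a := (div_lt_iff₀ ha).1 (Nat.lt_floor_add_one _)
  set r := t - M * v * b - k * a with hr
  have hr0 : 0 ≤ r / s := div_nonneg (by linarith) hs.le
  set j := ⌈r / s⌉₊
  have hj1 : r ≤ j * s := (div_le_iff₀ hs).1 (Nat.le_ceil _)
  have hj2 : j * s < r + s := by
    have := Nat.ceil_lt_add_one hr0
    calc j * s < (r / s + 1) * s := by gcongr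
      _ = r + s := by field_simp
  have hjM : j ≤ M := Nat.ceil_le.2 ((div_le_iff₀ hs).2 (by nlinarith))
  obtain ⟨d, hd⟩ := Nat.exists_eq_add_of_le hjM
  have hMd : (M : ℝ) = j + d := by exact_mod_cast hd
  refine ⟨k + j * u, d * v, ?_, ?_⟩ <;> push_cast <;> rw [hMd] at hr <;> nlinarith

/-- The group generated by `a` and `b` is dense, so it has an element in `(0, min δ (min a b))`. Its
coefficients cannot both be positive, since it lies below `a` and `b`, nor both nonpositive. It is
therefore a small step of the form required by `exists_natCombination_mem_Icc`, up to swapping `a`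
and `b`. -/
theorem exists_natCombination_near {a b : ℝ} (ha : 0 < a) (hb : 0 < b) (hab : Irrational (a / b))
    {δ : ℝ} (hδ : 0 < δ) :
    ∃ T : ℝ, ∀ t : ℝ, T ≤ t → ∃ i j : ℕ, t ≤ i * a + j * b ∧ i * a + j * b ≤ t + δ := by
  set c := min δ (min a b) with hc
  have hc0 : 0 < c := by positivity
  obtain ⟨w, ⟨hw0, hwc⟩, hw⟩ := (dense_addSubgroupClosure_pair_iff.2 hab).exists_mem_open
    isOpen_Ioo (Set.nonempty_Ioo.2 hc0) |>.imp fun _ h => h.symm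
  obtain ⟨p, q, rfl⟩ := AddSubgroup.mem_closure_pair.1 hw
  simp only [zsmul_eq_mul] at hw0 hwc
  have hwa : p * a + q * b < a := hwc.trans_le ((min_le_right _ _).trans (min_le_left _ _))
  have hwb : p * a + q * b < b := hwc.trans_le ((min_le_right _ _).trans (min_le_right _ _))
  have hwδ : p * a + q * b < δ := hwc.trans_le (min_le_left _ _)
  rcases lt_or_ge 0 p with hp | hp
  · have hq : q ≤ 0 := by
      by_contra! hq
      have h1 : (1 : ℝ) ≤ p := by exact_mod_cast hp
      have h2 : (1 : ℝ) ≤ q := by exact_mod_cast hq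
      nlinarith
    obtain ⟨u, rfl⟩ := Int.eq_ofNat_of_zero_le hp.le
    obtain ⟨v, hv⟩ := Int.eq_ofNat_of_zero_le (neg_nonneg.2 hq)
    obtain rfl : q = -v := by omega
    push_cast at *
    obtain ⟨T, hT⟩ := exists_natCombination_mem_Icc ha (b := b) (u := u) (v := v) (by linarith)
    refine ⟨T, fun t ht => ?_⟩
    obtain ⟨i, j, h1, h2⟩ := hT t ht
    exact ⟨i, j, h1, by linarith⟩
  · have hq : 0 ≤ q := by
      by_contra! hq
      have h1 : (p : ℝ) ≤ 0 := by exact_mod_cast hp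
      have h2 : (q : ℝ) < 0 := by exact_mod_cast hq
      nlinarith
    obtain ⟨u, rfl⟩ := Int.eq_ofNat_of_zero_le hq
    obtain ⟨v, hv⟩ := Int.eq_ofNat_of_zero_le (neg_nonneg.2 hp)
    obtain rfl : p = -v := by omega
    push_cast at *
    obtain ⟨T, hT⟩ := exists_natCombination_mem_Icc hb (b := a) (u := u) (v := v) (by linarith)
    refine ⟨T, fun t ht => ?_⟩
    obtain ⟨i, j, h1, h2⟩ := hT t ht
    exact ⟨j, i, by linarith, by linarith⟩

/-- A rational value would give `12 ^ k = 2 ^ d` with `k > 0`, but 3 divides only the left side. -/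
theorem irrational_log_two_div_log_twelve : Irrational (Real.log 2 / Real.log 12) := by
  rintro ⟨r, hr⟩
  have h12 : 0 < Real.log 12 := Real.log_pos (by norm_num)
  have h2 : 0 < Real.log 2 := Real.log_pos (by norm_num)
  have hrpos : (0 : ℝ) < r := hr ▸ div_pos h2 h12
  have hrpos' : 0 < r.num := Rat.num_pos.2 (by exact_mod_cast hrpos)
  obtain ⟨k, hk⟩ := Int.eq_ofNat_of_zero_le hrpos'.le
  rw [Rat.cast_def, hk, div_eq_div_iff (by positivity) h12.ne'] at hr
  have hlog : Real.log ((12 : ℝ) ^ k) = Real.log ((2 : ℝ) ^ r.den) := by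
    rw [Real.log_pow, Real.log_pow]
    push_cast at hr
    linarith
  have hpow : (12 : ℝ) ^ k = 2 ^ r.den :=
    Real.log_injOn_pos (Set.mem_Ioi.2 (by positivity)) (Set.mem_Ioi.2 (by positivity)) hlog
  have hpow' : 12 ^ k = 2 ^ r.den := by exact_mod_cast hpow
  have h3 : 3 ∣ 2 ^ r.den := hpow' ▸ dvd_pow (by norm_num) (by omega)
  exact absurd (Nat.prime_three.dvd_of_dvd_pow h3) (by norm_num)

/-! ### Hadamard orders -/

/-- There is an integer Hadamard matrix of order `m`. -/
def IsHadamardOrder (m : ℕ) : Prop :=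
  ∃ H : Matrix (Fin m) (Fin m) ℤ, H.IsHadamard

theorem Matrix.IsHadamard.isHadamardOrder {ι : Type*} [Fintype ι] [DecidableEq ι]
    {H : Matrix ι ι ℤ} (hH : H.IsHadamard) : IsHadamardOrder (Fintype.card ι) :=
  ⟨_, hH.reindex (Fintype.equivFin ι) (Fintype.equivFin ι)⟩

theorem IsHadamardOrder.mul {m k : ℕ} (hm : IsHadamardOrder m) (hk : IsHadamardOrder k) :
    IsHadamardOrder (m * k) := by
  obtain ⟨H, hH⟩ := hm
  obtain ⟨K, hK⟩ := hk
  simpa using (hH.kronecker hK).isHadamardOrder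

theorem isHadamardOrder_one : IsHadamardOrder 1 :=
  ⟨1, by constructor <;> simp [Unitary.mem_iff_eq_one_or_eq_neg_one]⟩

theorem IsHadamardOrder.pow {m : ℕ} (hm : IsHadamardOrder m) (k : ℕ) :
    IsHadamardOrder (m ^ k) := by
  induction k with
  | zero => simpa using isHadamardOrder_one
  | succ k ih => exact pow_succ m k ▸ ih.mul hm

theorem isHadamardOrder_of_rows_orthogonal {m : ℕ} (hm : 0 < m) (H : Fin m → Fin m → ℤ)
    (h1 : ∀ i j, H i j = 1 ∨ H i j = -1) (h2 : ∀ i k, ∑ j, H i j * H k j = if i = k then m else 0) :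
    IsHadamardOrder m := by
  refine ⟨Matrix.of H, Matrix.IsHadamard.of_mul_conjTranspose
    (fun i j => Unitary.mem_iff_eq_one_or_eq_neg_one.2 (h1 i j)) ?_
    (IsRegular.of_ne_zero (by simp [hm.ne']))⟩
  ext i k
  simp [Matrix.mul_apply, h2, Matrix.one_apply]

theorem isHadamardOrder_two : IsHadamardOrder 2 :=
  isHadamardOrder_of_rows_orthogonal two_pos ![![1, 1], ![1, -1]] (by decide) (by decide)

/-- Paley's Hadamard matrix for the field with `11` elements: `0` is the point at infinity. -/
def paleyTwelve : Fin 12 → Fin 12 → ℤ := fun i j =>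
  if i = j ∨ i = 0 then 1
  else if j = 0 then -1
  -- The list is the set of nonzero squares mod 11; adding 11 keeps the natural subtraction from
  -- truncating.
  else if (i.val + 11 - j.val) % 11 ∈ [1, 3, 4, 5, 9] then 1 else -1

theorem isHadamardOrder_twelve : IsHadamardOrder 12 :=
  isHadamardOrder_of_rows_orthogonal (by norm_num) paleyTwelve (by decide +kernel) (by decide +kernel)

/-- Hadamard orders are asymptotically dense on the multiplicative scale. -/
theorem exists_isHadamardOrder_near {ε : ℝ} (hε : 0 < ε) :
    ∃ N : ℕ, 0 < N ∧ ∀ n : ℕ, N < n →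
      ∃ m : ℕ, n ≤ m ∧ (m : ℝ) ≤ (1 + ε) * n ∧ IsHadamardOrder m := by
  have h12 : 0 < Real.log 12 := Real.log_pos (by norm_num)
  have h2 : 0 < Real.log 2 := Real.log_pos (by norm_num)
  obtain ⟨T, hT⟩ := exists_natCombination_near h2 h12 irrational_log_two_div_log_twelve
    (Real.log_pos (by linarith : 1 < 1 + ε))
  obtain ⟨N, hN⟩ := exists_nat_ge (Real.exp T)
  refine ⟨N + 1, N.succ_pos, fun n hn => ?_⟩
  have hNn : (N : ℝ) ≤ n := by exact_mod_cast (by omega : N ≤ n)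
  have hn0 : (0 : ℝ) < n := (Real.exp_pos T).trans_le (hN.trans hNn)
  obtain ⟨i, j, h1, h3⟩ := hT (Real.log n) ((Real.le_log_iff_exp_le hn0).2 (hN.trans hNn))
  have hlog : i * Real.log 2 + j * Real.log 12 = Real.log ((2 : ℝ) ^ i * 12 ^ j) := by
    rw [Real.log_mul (by positivity) (by positivity), Real.log_pow, Real.log_pow]
  rw [hlog] at h1 h3
  rw [← Real.log_mul hn0.ne' (by positivity)] at h3
  refine ⟨2 ^ i * 12 ^ j, ?_, ?_, (isHadamardOrder_two.pow i).mul (isHadamardOrder_twelve.pow j)⟩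
  · exact_mod_cast (Real.log_le_log_iff hn0 (by positivity)).1 h1
  · push_cast
    rw [mul_comm (1 + ε)]
    exact (Real.log_le_log_iff (by positivity) (by positivity)).1 h3

/-! ### Complex interpolation between `ℓ₁ × ℓ₁` and `ℓ₂ × ℓ₂` -/

theorem norm_sum_sum_mul_le {𝕜 ι κ : Type*} [RCLike 𝕜] [Fintype ι] [Fintype κ] {s : ι → κ → 𝕜}
    (hs : ∀ i j, ‖s i j‖ ≤ 1) (x : ι → 𝕜) (y : κ → 𝕜) :
    ‖∑ i, ∑ j, s i j * x i * y j‖ ≤ (∑ i, ‖x i‖) * ∑ j, ‖y j‖ := by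
  rw [Finset.sum_mul_sum]
  refine norm_sum_le_of_le _ fun i _ => norm_sum_le_of_le _ fun j _ => ?_
  rw [norm_mul, norm_mul]
  have := mul_le_mul_of_nonneg_right (hs i j) (mul_nonneg (norm_nonneg (x i)) (norm_nonneg (y j)))
  linarith

/-- The holomorphic deformation `z ↦ sgn x * |x| ^ (p * (1 - z / 2))` used for interpolation. -/
noncomputable def stripDeform (p : ℝ) (x z : ℂ) : ℂ :=
  x / ‖x‖ * Complex.exp (Real.log ‖x‖ * (p * (1 - z / 2)))

theorem differentiable_stripDeform (p : ℝ) (x : ℂ) : Differentiable ℂ (stripDeform p x) := by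
  unfold stripDeform
  fun_prop

/-- For `x = 0` the factor `x / ‖x‖` is `0 / 0 = 0`; the hypothesis rules out `0 ^ 0 = 1` on the
right. -/
theorem norm_stripDeform {p : ℝ} {x z : ℂ} (h : p * (1 - z.re / 2) ≠ 0) :
    ‖stripDeform p x z‖ = ‖x‖ ^ (p * (1 - z.re / 2)) := by
  rcases eq_or_ne x 0 with rfl | hx
  · simp [stripDeform, Real.zero_rpow h]
  · have hx' : 0 < ‖x‖ := norm_pos_iff.2 hx
    rw [stripDeform, norm_mul, norm_div, Complex.norm_real, norm_norm, div_self hx'.ne', one_mul,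
      Complex.norm_exp, Real.rpow_def_of_pos hx']
    congr 1
    simp

theorem stripDeform_eq_self {p : ℝ} (hp : p ≠ 0) (x : ℂ) :
    stripDeform p x ((2 - 2 / p : ℝ) : ℂ) = x := by
  rcases eq_or_ne x 0 with rfl | hx
  · simp [stripDeform]
  · have hx' : 0 < ‖x‖ := norm_pos_iff.2 hx
    have hpC : (p : ℂ) ≠ 0 := by exact_mod_cast hp
    have h : (p : ℂ) * (1 - ((2 - 2 / p : ℝ) : ℂ) / 2) = 1 := by
      push_cast
      field_simp
      ring
    rw [stripDeform, h, mul_one, ← Complex.ofReal_exp, Real.exp_log hx']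
    exact div_mul_cancel₀ _ (by exact_mod_cast hx'.ne')

/-- Crude bound, used only for the boundedness on the strip that the three lines theorem requires.
-/
theorem sum_norm_stripDeform_le_card {ι : Type*} [Fintype ι] {p : ℝ} (hp : 0 < p) {w : ι → ℂ}
    (hw : ∑ i, ‖w i‖ ^ p ≤ 1) {z : ℂ} (hz : z.re ≤ 1) :
    ∑ i, ‖stripDeform p (w i) z‖ ≤ Fintype.card ι := by
  have hexp : 0 < p * (1 - z.re / 2) := mul_pos hp (by linarith)
  rw [← nsmul_one, ← Finset.card_univ]
  refine Finset.sum_le_card_nsmul _ _ _ fun i _ => ?_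
  rw [norm_stripDeform hexp.ne']
  refine Real.rpow_le_one (norm_nonneg _) ?_ hexp.le
  have h1 : ‖w i‖ ^ p ≤ 1 :=
    (Finset.single_le_sum (f := fun i => ‖w i‖ ^ p) (fun i _ => by positivity)
      (Finset.mem_univ i)).trans hw
  exact (Real.rpow_le_rpow_iff (norm_nonneg _) zero_le_one hp).1 (by rwa [Real.one_rpow])

theorem sum_norm_stripDeform_le_one {ι : Type*} [Fintype ι] {p : ℝ} (hp : 0 < p) {w : ι → ℂ}
    (hw : ∑ i, ‖w i‖ ^ p ≤ 1) {z : ℂ} (hz : z.re = 0) :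
    ∑ i, ‖stripDeform p (w i) z‖ ≤ 1 := by
  refine le_of_eq_of_le (Finset.sum_congr rfl fun i _ => ?_) hw
  rw [norm_stripDeform (by simpa [hz] using hp.ne'), hz]
  simp

theorem sqrt_sum_norm_stripDeform_sq_le_one {ι : Type*} [Fintype ι] {p : ℝ} (hp : 0 < p)
    {w : ι → ℂ} (hw : ∑ i, ‖w i‖ ^ p ≤ 1) {z : ℂ} (hz : z.re = 1) :
    √(∑ i, ‖stripDeform p (w i) z‖ ^ 2) ≤ 1 := by
  refine Real.sqrt_le_one.2 (le_of_eq_of_le (Finset.sum_congr rfl fun i _ => ?_) hw)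
  rw [norm_stripDeform (by rw [hz]; norm_num; exact hp.ne'), hz, ← Real.rpow_natCast,
    ← Real.rpow_mul (norm_nonneg _)]
  congr 1
  push_cast
  ring

open Complex.HadamardThreeLines in
/-- Interpolation between `ℓ₁ × ℓ₁` and `ℓ₂ × ℓ₂` for bilinear forms with bounded coefficients,
on the unit ball of `ℓ_p × ℓ_p`. -/
theorem norm_sum_sum_le_of_sum_rpow_le_one {ι κ : Type*} [Fintype ι] [Fintype κ] {s : ι → κ → ℂ}
    {b p : ℝ} (hs : ∀ i j, ‖s i j‖ ≤ 1)
    (h2 : ∀ (x : ι → ℂ) (y : κ → ℂ),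
      ‖∑ i, ∑ j, s i j * x i * y j‖ ≤ b * √(∑ i, ‖x i‖ ^ 2) * √(∑ j, ‖y j‖ ^ 2))
    (hb : 0 ≤ b) (hp1 : 1 ≤ p) (hp2 : p ≤ 2) {x : ι → ℂ} {y : κ → ℂ}
    (hx : ∑ i, ‖x i‖ ^ p ≤ 1) (hy : ∑ j, ‖y j‖ ^ p ≤ 1) :
    ‖∑ i, ∑ j, s i j * x i * y j‖ ≤ b ^ (2 - 2 / p) := by
  have hp0 : 0 < p := by linarith
  -- `F` is bounded by 1 on `Re z = 0` and by `b` on `Re z = 1`. It equals the form at `θ = 2 - 2 /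
  -- p`, the solution of `1 / p = (1 - θ) + θ / 2`.
  set F : ℂ → ℂ := fun z => ∑ i, ∑ j, s i j * stripDeform p (x i) z * stripDeform p (y j) z with hF
  have hFd : Differentiable ℂ F := by
    have := differentiable_stripDeform p
    simp only [hF]
    fun_prop
  have hθ0 : 0 ≤ 2 - 2 / p := by
    have : 2 / p ≤ 2 := (div_le_iff₀ hp0).2 (by linarith)
    linarith
  have hθ1 : 2 - 2 / p ≤ 1 := by
    have : 1 ≤ 2 / p := (le_div_iff₀ hp0).2 (by linarith)
    linarith
  have key := norm_le_interp_of_mem_verticalClosedStrip₀₁' F (z := ((2 - 2 / p : ℝ) : ℂ))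
    (a := 1) (b := b) ⟨by simpa using hθ0, by simpa using hθ1⟩ hFd.diffContOnCl ?_ ?_ ?_
  · simpa [hF, stripDeform_eq_self hp0.ne', -Complex.ofReal_sub, -Complex.ofReal_div] using key
  · refine ⟨Fintype.card ι * Fintype.card κ, ?_⟩
    rintro _ ⟨z, hz, rfl⟩
    exact (norm_sum_sum_mul_le hs _ _).trans
      (mul_le_mul (sum_norm_stripDeform_le_card hp0 hx hz.2)
        (sum_norm_stripDeform_le_card hp0 hy hz.2) (by positivity) (by positivity))
  · intro z hz
    exact (norm_sum_sum_mul_le hs _ _).trans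
      (mul_le_one₀ (sum_norm_stripDeform_le_one hp0 hx hz) (by positivity)
        (sum_norm_stripDeform_le_one hp0 hy hz))
  · intro z hz
    calc ‖F z‖ ≤ _ := h2 _ _
      _ ≤ b * 1 * 1 := by
        gcongr
        exacts [sqrt_sum_norm_stripDeform_sq_le_one hp0 hx hz,
          sqrt_sum_norm_stripDeform_sq_le_one hp0 hy hz]
      _ = b := by ring

/-! ### Hadamard submatrices on `ℓ₂ × ℓ₂` -/

/-- Combining the selected rows over all `m` columns multiplies the `ℓ₂` norm by exactly `√m`.
Dropping columns only decreases it, and Cauchy–Schwarz handles `y`. -/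
theorem Matrix.IsHadamard.norm_sum_sum_submatrix_le {m : ℕ} {H : Matrix (Fin m) (Fin m) ℤ}
    (hH : H.IsHadamard) {ι κ : Type*} [Fintype ι] [Fintype κ] (f : ι ↪ Fin m) (g : κ ↪ Fin m)
    (x : ι → ℂ) (y : κ → ℂ) :
    ‖∑ i, ∑ j, (H (f i) (g j) : ℂ) * x i * y j‖ ≤
      √m * √(∑ i, ‖x i‖ ^ 2) * √(∑ j, ‖y j‖ ^ 2) := by
  classical
  set v : Fin m → ℂ := fun k => ∑ i, (H (f i) k : ℂ) * x i with hv
  have horth : ∀ i i', ∑ k, (H (f i) k : ℂ) * H (f i') k = if i = i' then (m : ℂ) else 0 := by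
    intro i i'
    have h := congr_fun (congr_fun hH.mul_conjTranspose (f i)) (f i')
    simp only [Matrix.mul_apply, Matrix.conjTranspose_apply, star_trivial, Fintype.card_fin,
      Matrix.smul_apply, Matrix.one_apply, f.injective.eq_iff, smul_eq_mul, mul_ite, mul_one,
      mul_zero] at h
    exact_mod_cast h
  have hvC : ∑ k, v k * star (v k) = m * ∑ i, x i * star (x i) := by
    calc ∑ k, v k * star (v k)
        = ∑ k, ∑ i, ∑ i', ((H (f i) k : ℂ) * H (f i') k) * (x i * star (x i')) := by
          refine Finset.sum_congr rfl fun k _ => ?_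
          rw [hv, star_sum, Finset.sum_mul_sum]
          refine Finset.sum_congr rfl fun i _ => Finset.sum_congr rfl fun i' _ => ?_
          simp only [star_mul', star_intCast]
          ring
      _ = ∑ i, ∑ i', (∑ k, (H (f i) k : ℂ) * H (f i') k) * (x i * star (x i')) := by
          rw [Finset.sum_comm]
          refine Finset.sum_congr rfl fun i _ => ?_
          rw [Finset.sum_comm]
          simp_rw [Finset.sum_mul]
      _ = m * ∑ i, x i * star (x i) := by
          simp [horth, Finset.mul_sum]
  have hvR : ∑ k, ‖v k‖ ^ 2 = m * ∑ i, ‖x i‖ ^ 2 := by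
    simp only [Complex.star_def, Complex.mul_conj'] at hvC
    exact_mod_cast hvC
  have hsub : ∑ j, ‖v (g j)‖ ^ 2 ≤ ∑ k, ‖v k‖ ^ 2 := by
    rw [← Finset.sum_map Finset.univ g (fun k => ‖v k‖ ^ 2)]
    exact Finset.sum_le_sum_of_subset_of_nonneg (Finset.subset_univ _) fun _ _ _ => by positivity
  calc ‖∑ i, ∑ j, (H (f i) (g j) : ℂ) * x i * y j‖ = ‖∑ j, v (g j) * y j‖ := by
        rw [Finset.sum_comm]
        simp only [hv, Finset.sum_mul]
    _ ≤ ∑ j, ‖v (g j)‖ * ‖y j‖ := norm_sum_le_of_le _ fun j _ => (norm_mul _ _).le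
    _ ≤ √(∑ j, ‖v (g j)‖ ^ 2) * √(∑ j, ‖y j‖ ^ 2) := Real.sum_mul_le_sqrt_mul_sqrt _ _ _
    _ ≤ √(m * ∑ i, ‖x i‖ ^ 2) * √(∑ j, ‖y j‖ ^ 2) := by
        rw [← hvR]
        gcongr
    _ = √m * √(∑ i, ‖x i‖ ^ 2) * √(∑ j, ‖y j‖ ^ 2) := by
        rw [Real.sqrt_mul (Nat.cast_nonneg m)]

/-- Lets the interpolation, which needs complex scalars, serve the real case too. -/
theorem RCLike.exists_norm_preserving_ringHom_complex (𝕜 : Type*) [RCLike 𝕜] :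
    ∃ φ : 𝕜 →+* ℂ, ∀ x, ‖φ x‖ = ‖x‖ := by
  refine ⟨{ toFun := fun x => ⟨RCLike.re x, RCLike.im x⟩, map_one' := ?_, map_mul' := ?_,
            map_zero' := ?_, map_add' := ?_ }, fun x => ?_⟩
  · apply Complex.ext <;> simp
  · intro x y; apply Complex.ext <;> simp
  · apply Complex.ext <;> simp
  · intro x y; apply Complex.ext <;> simp
  · rw [← sq_eq_sq₀ (norm_nonneg _) (norm_nonneg _), ← Complex.normSq_eq_norm_sq,
      RCLike.norm_sq_eq_def]
    simp [Complex.normSq_apply]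

/-! ### Exponents and comparison of `ℓ_p` norms -/

theorem recip_eq_inv_toReal (p : ℝ≥0∞) : recip p = p.toReal⁻¹ := by
  simp [recip]

theorem recip_nonneg (p : ℝ≥0∞) : 0 ≤ recip p := ENNReal.toReal_nonneg

theorem recip_anti {p q : ℝ≥0∞} (hp : 1 ≤ p) (hpq : p ≤ q) : recip q ≤ recip p := by
  have hp0 : p ≠ 0 := (zero_lt_one.trans_le hp).ne'
  exact ENNReal.toReal_mono (by simpa using hp0) (ENNReal.div_le_div_left hpq 1)

theorem recip_two : recip 2 = 1 / 2 := by
  simp [recip_eq_inv_toReal]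

theorem recip_le_one {p : ℝ≥0∞} (hp : 1 ≤ p) : recip p ≤ 1 := by
  simpa [recip_eq_inv_toReal 1] using recip_anti le_rfl hp

theorem recip_conjExponent {p : ℝ≥0∞} (hp : 1 ≤ p) : recip p.conjExponent = 1 - recip p := by
  have hc := ENNReal.HolderConjugate.conjExponent hp
  have h := ENNReal.HolderConjugate.inv_add_inv_eq_one p p.conjExponent
  have hp' : p⁻¹ ≠ ∞ := by simpa using (zero_lt_one.trans_le hp).ne'
  have hq' : p.conjExponent⁻¹ ≠ ∞ := fun h' => by simp [h'] at h
  have := congrArg ENNReal.toReal h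
  rw [ENNReal.toReal_add hp' hq', ENNReal.toReal_one] at this
  simp only [recip, one_div]
  linarith

section PiLpNorm

variable {ι E : Type*} [Fintype ι] [NormedAddCommGroup E]

theorem PiLp.norm_toLp_rpow_eq_sum {p : ℝ≥0∞} [Fact (1 ≤ p)] (hp : p ≠ ∞) (x : ι → E) :
    ‖WithLp.toLp p x‖ ^ p.toReal = ∑ i, ‖x i‖ ^ p.toReal := by
  have hp0 : 0 < p.toReal := ENNReal.toReal_pos (zero_lt_one.trans_le Fact.out).ne' hp
  rw [PiLp.norm_eq_sum hp0, ← Real.rpow_mul (by positivity), one_div,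
    inv_mul_cancel₀ hp0.ne', Real.rpow_one]

/-- Each `‖x i‖` is at most `‖x‖_p`, so `‖x i‖ ^ q ≤ ‖x‖_p ^ (q - p) * ‖x i‖ ^ p`; sum over `i`. -/
theorem PiLp.norm_toLp_anti {p q : ℝ≥0∞} [Fact (1 ≤ p)] [Fact (1 ≤ q)] (hpq : p ≤ q) (hq : q ≠ ∞)
    (x : ι → E) : ‖WithLp.toLp q x‖ ≤ ‖WithLp.toLp p x‖ := by
  have hp : p ≠ ∞ := ne_top_of_le_ne_top hq hpq
  have hp0 : 0 < p.toReal := ENNReal.toReal_pos (zero_lt_one.trans_le Fact.out).ne' hp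
  have hq0 : 0 < q.toReal := ENNReal.toReal_pos (zero_lt_one.trans_le Fact.out).ne' hq
  have hpq' : p.toReal ≤ q.toReal := ENNReal.toReal_mono hq hpq
  refine (Real.rpow_le_rpow_iff (norm_nonneg _) (norm_nonneg _) hq0).1 ?_
  have hsplit : ∀ a : ℝ, 0 ≤ a → a ^ q.toReal = a ^ (q.toReal - p.toReal) * a ^ p.toReal := by
    intro a ha
    rw [← Real.rpow_add_of_nonneg ha (by linarith) hp0.le, sub_add_cancel]
  rw [PiLp.norm_toLp_rpow_eq_sum hq, hsplit _ (norm_nonneg _), PiLp.norm_toLp_rpow_eq_sum hp,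
    Finset.mul_sum]
  refine Finset.sum_le_sum fun i _ => ?_
  rw [hsplit _ (norm_nonneg _)]
  gcongr
  exact PiLp.norm_apply_le (WithLp.toLp p x) i

theorem PiLp.norm_toLp_two_le_of_two_le {p : ℝ≥0∞} [Fact (1 ≤ p)] (hp2 : 2 ≤ p) (x : ι → E) :
    ‖WithLp.toLp 2 x‖ ≤ (Fintype.card ι : ℝ) ^ (1 / 2 - recip p) * ‖WithLp.toLp p x‖ := by
  refine (sq_le_sq₀ (norm_nonneg _) (by positivity)).1 ?_
  rw [PiLp.norm_sq_eq_of_L2, mul_pow, ← Real.rpow_natCast (_ ^ _), ← Real.rpow_mul (by positivity),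
    Nat.cast_ofNat]
  rcases eq_or_ne p ∞ with rfl | hp
  · have h : (1 / 2 - recip ∞) * 2 = 1 := by simp [recip]
    rw [h, Real.rpow_one, ← nsmul_eq_mul, ← Finset.card_univ]
    refine Finset.sum_le_card_nsmul _ _ _ fun i _ => ?_
    gcongr
    exact PiLp.norm_apply_le (WithLp.toLp ∞ x) i
  · set r := p.toReal with hr
    have hr2 : 2 ≤ r := by simpa using ENNReal.toReal_mono hp hp2
    have hr0 : 0 < r := by linarith
    -- Power mean inequality with exponent `r / 2 ≥ 1`, applied to the squares.
    have hmean := Real.rpow_sum_le_const_mul_sum_rpow Finset.univ (fun i => ‖x i‖ ^ 2)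
      (by linarith : 1 ≤ r / 2)
    have hterm : ∀ a : ℝ, 0 ≤ a → (a ^ 2) ^ (r / 2) = a ^ r := by
      intro a ha
      rw [← Real.rpow_natCast, ← Real.rpow_mul ha]
      congr 1
      push_cast
      ring
    simp only [abs_of_nonneg (sq_nonneg (‖_‖)), hterm _ (norm_nonneg _),
      Finset.card_univ] at hmean
    rw [← PiLp.norm_toLp_rpow_eq_sum hp] at hmean
    refine (Real.rpow_le_rpow_iff (by positivity) (by positivity) (by linarith : 0 < r / 2)).1 ?_
    refine hmean.trans_eq ?_
    rw [Real.mul_rpow (by positivity) (by positivity), hterm _ (norm_nonneg _),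
      ← Real.rpow_mul (by positivity), recip_eq_inv_toReal, ← hr]
    congr 2
    field_simp

theorem PiLp.norm_toLp_two_le {p : ℝ≥0∞} [Fact (1 ≤ p)] (x : ι → E) :
    ‖WithLp.toLp 2 x‖ ≤ (Fintype.card ι : ℝ) ^ max (1 / 2 - recip p) 0 * ‖WithLp.toLp p x‖ := by
  rcases le_total p 2 with hp | hp
  · have h : max (1 / 2 - recip p) 0 = 0 :=
      max_eq_right (by linarith [recip_anti Fact.out hp, recip_two])
    rw [h, Real.rpow_zero, one_mul]
    exact PiLp.norm_toLp_anti hp (by simp) x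
  · have h : max (1 / 2 - recip p) 0 = 1 / 2 - recip p :=
      max_eq_left (by linarith [recip_anti one_le_two hp, recip_two])
    rw [h]
    exact PiLp.norm_toLp_two_le_of_two_le hp x

theorem PiLp.norm_toLp_of_norm_eq_one {p : ℝ≥0∞} [Fact (1 ≤ p)] (hp : p ≠ ∞) {x : ι → E}
    (hx : ∀ i, ‖x i‖ = 1) : ‖WithLp.toLp p x‖ = (Fintype.card ι : ℝ) ^ recip p := by
  have hp0 : 0 < p.toReal := ENNReal.toReal_pos (zero_lt_one.trans_le Fact.out).ne' hp
  rw [PiLp.norm_eq_sum hp0, recip_eq_inv_toReal]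
  simp [hx]

end PiLpNorm

/-! ### Upper bound for Hadamard submatrices -/

theorem PiLp.sum_norm_rpow_inv_norm_smul {ι : Type*} [Fintype ι] {p : ℝ≥0∞} [Fact (1 ≤ p)]
    (hp : p ≠ ∞) {x : ι → ℂ} (hx : WithLp.toLp p x ≠ 0) :
    ∑ i, ‖((‖WithLp.toLp p x‖⁻¹ : ℝ) : ℂ) * x i‖ ^ p.toReal = 1 := by
  have h := (PiLp.norm_toLp_rpow_eq_sum hp ((‖WithLp.toLp p x‖⁻¹ : ℝ) • x)).symm
  rw [WithLp.toLp_smul, norm_smul, norm_inv, norm_norm, inv_mul_cancel₀ (norm_ne_zero_iff.2 hx),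
    Real.one_rpow] at h
  simpa using h

theorem Matrix.IsHadamard.norm_sum_sum_submatrix_le_toLp_complex {m : ℕ}
    {H : Matrix (Fin m) (Fin m) ℤ} (hH : H.IsHadamard) {ι κ : Type*} [Fintype ι] [Fintype κ]
    (f : ι ↪ Fin m) (g : κ ↪ Fin m) {p : ℝ≥0∞} [Fact (1 ≤ p)] (hp : p ≤ 2) (x : ι → ℂ)
    (y : κ → ℂ) :
    ‖∑ i, ∑ j, (H (f i) (g j) : ℂ) * x i * y j‖ ≤
      (m : ℝ) ^ (1 - recip p) * ‖WithLp.toLp p x‖ * ‖WithLp.toLp p y‖ := by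
  have hp1 : 1 ≤ p := Fact.out
  have hptop : p ≠ ∞ := ne_top_of_le_ne_top (by simp) hp
  rcases eq_or_ne (WithLp.toLp p x) 0 with hx | hx
  · obtain rfl : x = 0 := by simpa using hx
    simp
  rcases eq_or_ne (WithLp.toLp p y) 0 with hy | hy
  · obtain rfl : y = 0 := by simpa using hy
    simp
  have hs : ∀ i j, ‖(H (f i) (g j) : ℂ)‖ ≤ 1 := fun i j => by
    rcases Unitary.mem_iff_eq_one_or_eq_neg_one.1 (hH.apply_mem (f i) (g j)) with h | h <;> simp [h]
  have key := norm_sum_sum_le_of_sum_rpow_le_one hs (hH.norm_sum_sum_submatrix_le f g)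
    (Real.sqrt_nonneg _) (by simpa using ENNReal.toReal_mono hptop hp1)
    (by simpa using ENNReal.toReal_mono (by simp) hp)
    (PiLp.sum_norm_rpow_inv_norm_smul hptop hx).le (PiLp.sum_norm_rpow_inv_norm_smul hptop hy).le
  have hx0 := norm_pos_iff.2 hx
  have hy0 := norm_pos_iff.2 hy
  have hpow : √m ^ (2 - 2 / p.toReal) = (m : ℝ) ^ (1 - recip p) := by
    rw [Real.sqrt_eq_rpow, ← Real.rpow_mul (Nat.cast_nonneg m), recip_eq_inv_toReal]
    congr 1
    ring
  have hfactor : ∑ i, ∑ j, (H (f i) (g j) : ℂ) * (((‖WithLp.toLp p x‖⁻¹ : ℝ) : ℂ) * x i) *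
        (((‖WithLp.toLp p y‖⁻¹ : ℝ) : ℂ) * y j) =
      ((‖WithLp.toLp p x‖⁻¹ * ‖WithLp.toLp p y‖⁻¹ : ℝ) : ℂ) *
        ∑ i, ∑ j, (H (f i) (g j) : ℂ) * x i * y j := by
    simp_rw [Finset.mul_sum]
    refine Finset.sum_congr rfl fun i _ => Finset.sum_congr rfl fun j _ => ?_
    push_cast
    ring
  rw [hfactor, hpow, norm_mul, Complex.norm_real, Real.norm_of_nonneg (by positivity), ← mul_inv,
    inv_mul_le_iff₀ (by positivity)] at key
  linarith

/-- A submatrix of a Hadamard matrix of order `m` is bounded by `m ^ (1 - 1 / p)` on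
`ℓ_p × ℓ_p` for `1 ≤ p ≤ 2`. -/
theorem Matrix.IsHadamard.norm_sum_sum_submatrix_le_toLp {𝕜 : Type*} [RCLike 𝕜] {m : ℕ}
    {H : Matrix (Fin m) (Fin m) ℤ} (hH : H.IsHadamard) {ι κ : Type*} [Fintype ι] [Fintype κ]
    (f : ι ↪ Fin m) (g : κ ↪ Fin m) {p : ℝ≥0∞} [Fact (1 ≤ p)] (hp : p ≤ 2) (x : ι → 𝕜)
    (y : κ → 𝕜) :
    ‖∑ i, ∑ j, (H (f i) (g j) : 𝕜) * x i * y j‖ ≤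
      (m : ℝ) ^ (1 - recip p) * ‖WithLp.toLp p x‖ * ‖WithLp.toLp p y‖ := by
  have hp1 : 1 ≤ p := Fact.out
  have hptop : p ≠ ∞ := ne_top_of_le_ne_top (by simp) hp
  have hp0 : 0 < p.toReal := ENNReal.toReal_pos (zero_lt_one.trans_le hp1).ne' hptop
  obtain ⟨φ, hφ⟩ := RCLike.exists_norm_preserving_ringHom_complex 𝕜
  have h := hH.norm_sum_sum_submatrix_le_toLp_complex f g hp (φ ∘ x) (φ ∘ y)
  have hsum : ∑ i, ∑ j, (H (f i) (g j) : ℂ) * (φ ∘ x) i * (φ ∘ y) j =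
      φ (∑ i, ∑ j, (H (f i) (g j) : 𝕜) * x i * y j) := by
    simp
  rw [hsum, hφ] at h
  simpa [PiLp.norm_eq_sum hp0, hφ] using h

theorem bennettBound_of_le_two {p₁ p₂ : ℝ≥0∞} (h₁ : 1 ≤ p₁) (h₂ : 1 ≤ p₂) (hp₁ : p₁ ≤ 2)
    (hp₂ : p₂ ≤ 2) {n : ℕ} (hn : 0 < n) :
    bennettBound p₁ p₂ n = (n : ℝ) ^ (1 - recip (max p₁ p₂)) := by
  have hn1 : (1 : ℝ) ≤ n := by exact_mod_cast hn
  have h0 : ∀ {p : ℝ≥0∞}, 1 ≤ p → p ≤ 2 → max (1 / 2 - recip p) 0 = 0 := fun h1 h2 =>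
    max_eq_right (by linarith [recip_anti h1 h2, recip_two])
  rw [bennettBound, recip_conjExponent h₁, recip_conjExponent h₂, h0 h₁ hp₁, h0 h₂ hp₂,
    Real.rpow_zero, mul_one, mul_one]
  rcases le_total p₁ p₂ with h | h
  · rw [max_eq_right h, max_eq_left]
    exact Real.rpow_le_rpow_of_exponent_le hn1 (by linarith [recip_anti h₁ h])
  · rw [max_eq_left h, max_eq_right]
    exact Real.rpow_le_rpow_of_exponent_le hn1 (by linarith [recip_anti h₂ h])

/-- An index `p ≥ 2` absorbs the root: `√n * n ^ (1/2 - 1/p) = n ^ (1 - 1/p)`. The left side is then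
one of the two entries of the maximum. -/
theorem sqrt_mul_rpow_mul_rpow_le_bennettBound {p₁ p₂ : ℝ≥0∞} (h₁ : 1 ≤ p₁) (h₂ : 1 ≤ p₂)
    (hp : 2 ≤ p₁ ∨ 2 ≤ p₂) {n : ℕ} (hn : 0 < n) :
    √n * (n : ℝ) ^ max (1 / 2 - recip p₁) 0 * (n : ℝ) ^ max (1 / 2 - recip p₂) 0 ≤
      bennettBound p₁ p₂ n := by
  have hn0 : (0 : ℝ) < n := by exact_mod_cast hn
  have h : ∀ {p : ℝ≥0∞}, 2 ≤ p →
      √n * (n : ℝ) ^ max (1 / 2 - recip p) 0 = (n : ℝ) ^ (1 - recip p) := fun hp => by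
    rw [max_eq_left (by linarith [recip_anti one_le_two hp, recip_two]), Real.sqrt_eq_rpow,
      ← Real.rpow_add hn0]
    congr 1
    ring
  rw [bennettBound, recip_conjExponent h₁, recip_conjExponent h₂]
  rcases hp with hp | hp
  · rw [h hp]
    exact le_max_right _ _
  · rw [mul_right_comm, h hp]
    exact le_max_left _ _

theorem Matrix.IsHadamard.norm_sum_sum_submatrix_le_bennettBound {𝕜 : Type*} [RCLike 𝕜] {m n : ℕ}
    {H : Matrix (Fin m) (Fin m) ℤ} (hH : H.IsHadamard) (f g : Fin n ↪ Fin m) {ε : ℝ} (hε : 0 ≤ ε)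
    (hn : 0 < n) (hm : (m : ℝ) ≤ (1 + ε) * n) {p₁ p₂ : ℝ≥0∞} [Fact (1 ≤ p₁)] [Fact (1 ≤ p₂)]
    (x y : Fin n → 𝕜) :
    ‖∑ i, ∑ j, (H (f i) (g j) : 𝕜) * x i * y j‖ ≤
      (1 + ε) * bennettBound p₁ p₂ n * ‖WithLp.toLp p₁ x‖ * ‖WithLp.toLp p₂ y‖ := by
  have h₁ : 1 ≤ p₁ := Fact.out
  have h₂ : 1 ≤ p₂ := Fact.out
  -- Since `t ≤ 1`, the loss `(1 + ε) ^ t` is at most `1 + ε`; this makes the estimate uniform in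
  -- the exponents.
  have hconst : ∀ {t : ℝ}, 0 ≤ t → t ≤ 1 → (m : ℝ) ^ t ≤ (1 + ε) * (n : ℝ) ^ t := by
    intro t ht0 ht1
    calc (m : ℝ) ^ t ≤ ((1 + ε) * n) ^ t := by gcongr
      _ = (1 + ε) ^ t * (n : ℝ) ^ t := Real.mul_rpow (by linarith) (Nat.cast_nonneg n)
      _ ≤ (1 + ε) * (n : ℝ) ^ t := by
        gcongr
        simpa using Real.rpow_le_rpow_of_exponent_le (by linarith : 1 ≤ 1 + ε) ht1
  by_cases hp : p₁ ≤ 2 ∧ p₂ ≤ 2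
  · have hmax : max p₁ p₂ ≤ 2 := max_le hp.1 hp.2
    have hmax1 : 1 ≤ max p₁ p₂ := h₁.trans (le_max_left _ _)
    have hmaxtop : max p₁ p₂ ≠ ∞ := ne_top_of_le_ne_top (by simp) hmax
    have : Fact (1 ≤ max p₁ p₂) := ⟨hmax1⟩
    rw [bennettBound_of_le_two h₁ h₂ hp.1 hp.2 hn]
    refine (hH.norm_sum_sum_submatrix_le_toLp f g hmax x y).trans ?_
    have hr0 := recip_nonneg (max p₁ p₂)
    have hr1 := recip_le_one hmax1
    gcongr
    · exact hconst (by linarith) (by linarith)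
    · exact PiLp.norm_toLp_anti (le_max_left _ _) hmaxtop x
    · exact PiLp.norm_toLp_anti (le_max_right _ _) hmaxtop y
  · have hp' : 2 ≤ p₁ ∨ 2 ≤ p₂ := by
      by_contra! h
      exact hp ⟨h.1.le, h.2.le⟩
    have hB := sqrt_mul_rpow_mul_rpow_le_bennettBound h₁ h₂ hp' hn
    have hx : ‖WithLp.toLp 2 x‖ ≤ (n : ℝ) ^ max (1 / 2 - recip p₁) 0 * ‖WithLp.toLp p₁ x‖ := by
      simpa using PiLp.norm_toLp_two_le (p := p₁) x
    have hy : ‖WithLp.toLp 2 y‖ ≤ (n : ℝ) ^ max (1 / 2 - recip p₂) 0 * ‖WithLp.toLp p₂ y‖ := by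
      simpa using PiLp.norm_toLp_two_le (p := p₂) y
    have hsqrt : (m : ℝ) ^ (1 - recip 2) ≤ (1 + ε) * √n := by
      rw [recip_two, Real.sqrt_eq_rpow, show (1 : ℝ) - 1 / 2 = 1 / 2 by norm_num]
      exact hconst (by norm_num) (by norm_num)
    calc ‖∑ i, ∑ j, (H (f i) (g j) : 𝕜) * x i * y j‖
        ≤ (m : ℝ) ^ (1 - recip 2) * ‖WithLp.toLp 2 x‖ * ‖WithLp.toLp 2 y‖ :=
          hH.norm_sum_sum_submatrix_le_toLp f g le_rfl x y
      _ ≤ ((1 + ε) * √n) * ((n : ℝ) ^ max (1 / 2 - recip p₁) 0 * ‖WithLp.toLp p₁ x‖) *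
          ((n : ℝ) ^ max (1 / 2 - recip p₂) 0 * ‖WithLp.toLp p₂ y‖) := by gcongr
      _ = (1 + ε) * (√n * (n : ℝ) ^ max (1 / 2 - recip p₁) 0 *
          (n : ℝ) ^ max (1 / 2 - recip p₂) 0) * ‖WithLp.toLp p₁ x‖ * ‖WithLp.toLp p₂ y‖ := by ring
      _ ≤ (1 + ε) * bennettBound p₁ p₂ n * ‖WithLp.toLp p₁ x‖ * ‖WithLp.toLp p₂ y‖ := by gcongr

theorem bennettBound_nonneg (p₁ p₂ : ℝ≥0∞) (n : ℕ) : 0 ≤ bennettBound p₁ p₂ n :=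
  le_max_of_le_left (by positivity)

/-- The bilinear form with matrix `s`, as a linear map into linear maps. -/
noncomputable def matrixBilin {𝕜 : Type*} [RCLike 𝕜] (p₁ p₂ : ℝ≥0∞) {n : ℕ}
    (s : Fin n → Fin n → 𝕜) :
    PiLp p₁ (fun _ : Fin n => 𝕜) →ₗ[𝕜] PiLp p₂ (fun _ : Fin n => 𝕜) →ₗ[𝕜] 𝕜 :=
  LinearMap.mk₂ 𝕜 (fun x y => ∑ i, ∑ j, s i j * x i * y j)
    (fun x x' y => by simp [mul_add, add_mul, Finset.sum_add_distrib])
    (fun c x y => by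
      simp only [PiLp.smul_apply, smul_eq_mul, Finset.mul_sum]
      exact Finset.sum_congr rfl fun i _ => Finset.sum_congr rfl fun j _ => by ring)
    (fun x y y' => by simp [mul_add, Finset.sum_add_distrib])
    (fun c x y => by
      simp only [PiLp.smul_apply, smul_eq_mul, Finset.mul_sum]
      exact Finset.sum_congr rfl fun i _ => Finset.sum_congr rfl fun j _ => by ring)

theorem exists_isSignBilinForm_norm_le (𝕜 : Type*) [RCLike 𝕜] {ε : ℝ} (hε : 0 < ε) :
    ∃ N : ℕ, 0 < N ∧ ∀ (p₁ p₂ : ℝ≥0∞) [Fact (1 ≤ p₁)] [Fact (1 ≤ p₂)] (n : ℕ), N < n →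
      ∃ A : PiLp p₁ (fun _ : Fin n => 𝕜) →L[𝕜] PiLp p₂ (fun _ : Fin n => 𝕜) →L[𝕜] 𝕜,
        IsSignBilinForm A ∧ ‖A‖ ≤ (1 + ε) * bennettBound p₁ p₂ n := by
  obtain ⟨N, hN0, hN⟩ := exists_isHadamardOrder_near hε
  refine ⟨N, hN0, fun p₁ p₂ _ _ n hn => ?_⟩
  obtain ⟨m, hnm, hm, H, hH⟩ := hN n hn
  set e := Fin.castLEEmb hnm
  have hbound : ∀ x y, ‖matrixBilin p₁ p₂ (fun i j => (H (e i) (e j) : 𝕜)) x y‖ ≤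
      (1 + ε) * bennettBound p₁ p₂ n * ‖x‖ * ‖y‖ := fun x y =>
    hH.norm_sum_sum_submatrix_le_bennettBound e e hε.le (hN0.trans hn) hm x.ofLp y.ofLp
  refine ⟨(matrixBilin p₁ p₂ _).mkContinuous₂ _ hbound,
    ⟨fun i j => (H (e i) (e j) : 𝕜), fun i j => ?_, fun _ _ => rfl⟩,
    LinearMap.mkContinuous₂_norm_le _
      (mul_nonneg (by linarith) (bennettBound_nonneg p₁ p₂ n)) hbound⟩
  rcases Unitary.mem_iff_eq_one_or_eq_neg_one.1 (hH.apply_mem (e i) (e j)) with h | h <;> simp [h]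

/-! ### Lower bound for every sign form -/

theorem rpow_one_sub_recip_le_of_mul_le {n : ℕ} (hn : 0 < n) {a : ℝ} {p : ℝ≥0∞}
    (h : (n : ℝ) ≤ a * (n : ℝ) ^ recip p) : (n : ℝ) ^ (1 - recip p) ≤ a := by
  have hn0 : (0 : ℝ) < n := by exact_mod_cast hn
  rw [Real.rpow_sub hn0, Real.rpow_one]
  exact (div_le_iff₀ (by positivity)).2 h

theorem IsSignBilinForm.rpow_one_sub_recip_right_le_norm {𝕜 : Type*} [RCLike 𝕜] {p₁ p₂ : ℝ≥0∞}
    [Fact (1 ≤ p₁)] [Fact (1 ≤ p₂)] {n : ℕ} (hn : 0 < n) (hp₂ : p₂ ≠ ∞)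
    {A : PiLp p₁ (fun _ : Fin n => 𝕜) →L[𝕜] PiLp p₂ (fun _ : Fin n => 𝕜) →L[𝕜] 𝕜}
    (hA : IsSignBilinForm A) : (n : ℝ) ^ (1 - recip p₂) ≤ ‖A‖ := by
  obtain ⟨s, hs, hAs⟩ := hA
  set k : Fin n := ⟨0, hn⟩
  have hsq : ∀ j, s k j * s k j = 1 := fun j => by rcases hs k j with h | h <;> simp [h]
  have hnorm : ∀ j, ‖s k j‖ = 1 := fun j => by rcases hs k j with h | h <;> simp [h]
  -- Pairing row `k` with itself gives the value `n`, while the test vectors have norms `1` and `n ^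
  -- (1 / p₂)`.
  have h := A.le_opNorm₂ (PiLp.single p₁ k 1) (WithLp.toLp p₂ (s k))
  rw [PiLp.norm_single, PiLp.norm_toLp_of_norm_eq_one hp₂ hnorm, hAs] at h
  refine rpow_one_sub_recip_le_of_mul_le hn ?_
  simpa [Pi.single_apply, hsq] using h

theorem IsSignBilinForm.rpow_one_sub_recip_left_le_norm {𝕜 : Type*} [RCLike 𝕜] {p₁ p₂ : ℝ≥0∞}
    [Fact (1 ≤ p₁)] [Fact (1 ≤ p₂)] {n : ℕ} (hn : 0 < n) (hp₁ : p₁ ≠ ∞)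
    {A : PiLp p₁ (fun _ : Fin n => 𝕜) →L[𝕜] PiLp p₂ (fun _ : Fin n => 𝕜) →L[𝕜] 𝕜}
    (hA : IsSignBilinForm A) : (n : ℝ) ^ (1 - recip p₁) ≤ ‖A‖ := by
  obtain ⟨s, hs, hAs⟩ := hA
  set k : Fin n := ⟨0, hn⟩
  have hsq : ∀ i, s i k * s i k = 1 := fun i => by rcases hs i k with h | h <;> simp [h]
  have hnorm : ∀ i, ‖s i k‖ = 1 := fun i => by rcases hs i k with h | h <;> simp [h]
  have h := A.le_opNorm₂ (WithLp.toLp p₁ fun i => s i k) (PiLp.single p₂ k 1)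
  rw [PiLp.norm_single, PiLp.norm_toLp_of_norm_eq_one hp₁ hnorm, hAs] at h
  refine rpow_one_sub_recip_le_of_mul_le hn ?_
  simpa [Pi.single_apply, hsq] using h

theorem IsSignBilinForm.rpow_one_sub_recip_max_le_norm {𝕜 : Type*} [RCLike 𝕜] {p₁ p₂ : ℝ≥0∞}
    [Fact (1 ≤ p₁)] [Fact (1 ≤ p₂)] (hp₁ : p₁ ≠ ∞) (hp₂ : p₂ ≠ ∞) {n : ℕ} (hn : 0 < n)
    {A : PiLp p₁ (fun _ : Fin n => 𝕜) →L[𝕜] PiLp p₂ (fun _ : Fin n => 𝕜) →L[𝕜] 𝕜}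
    (hA : IsSignBilinForm A) : (n : ℝ) ^ (1 - recip (max p₁ p₂)) ≤ ‖A‖ := by
  rcases max_choice p₁ p₂ with h | h <;> rw [h]
  exacts [hA.rpow_one_sub_recip_left_le_norm hn hp₁, hA.rpow_one_sub_recip_right_le_norm hn hp₂]

/-! ### The theorem and optimality of the constant -/

theorem mainTheorem8 (𝕜 : Type*) [RCLike 𝕜] :
    (∀ ε : ℝ, 0 < ε → ∃ N : ℕ, 0 < N ∧
      ∀ (p₁ p₂ : ℝ≥0∞) [Fact (1 ≤ p₁)] [Fact (1 ≤ p₂)] (n : ℕ), N < n →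
        ∃ A : PiLp p₁ (fun _ : Fin n => 𝕜) →L[𝕜] PiLp p₂ (fun _ : Fin n => 𝕜) →L[𝕜] 𝕜,
          IsSignBilinForm A ∧ ‖A‖ ≤ (1 + ε) * bennettBound p₁ p₂ n) ∧
    (∀ (p₁ p₂ : ℝ≥0∞) [Fact (1 ≤ p₁)] [Fact (1 ≤ p₂)], p₁ ≤ 2 → p₂ ≤ 2 →
      (∀ n : ℕ, 0 < n →
        bennettBound p₁ p₂ n = (n : ℝ) ^ recip (max p₁ p₂).conjExponent ∧
        ∀ A : PiLp p₁ (fun _ : Fin n => 𝕜) →L[𝕜] PiLp p₂ (fun _ : Fin n => 𝕜) →L[𝕜] 𝕜,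
          IsSignBilinForm A → (n : ℝ) ^ recip (max p₁ p₂).conjExponent ≤ ‖A‖) ∧
      IsLeast {C : ℝ | ∀ ε : ℝ, 0 < ε → ∃ N : ℕ, 0 < N ∧ ∀ n : ℕ, N < n →
        ∃ A : PiLp p₁ (fun _ : Fin n => 𝕜) →L[𝕜] PiLp p₂ (fun _ : Fin n => 𝕜) →L[𝕜] 𝕜,
          IsSignBilinForm A ∧ ‖A‖ ≤ (C + ε) * bennettBound p₁ p₂ n} 1) := by
  refine ⟨fun ε hε => exists_isSignBilinForm_norm_le 𝕜 hε, ?_⟩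
  intro p₁ p₂ hf₁ hf₂ hp₁ hp₂
  have h₁ : p₁ ≠ ∞ := ne_top_of_le_ne_top (by simp) hp₁
  have h₂ : p₂ ≠ ∞ := ne_top_of_le_ne_top (by simp) hp₂
  have hB := fun {n : ℕ} => bennettBound_of_le_two hf₁.out hf₂.out hp₁ hp₂ (n := n)
  rw [recip_conjExponent (hf₁.out.trans (le_max_left p₁ p₂))]
  refine ⟨fun n hn => ⟨hB hn, fun A hA => hA.rpow_one_sub_recip_max_le_norm h₁ h₂ hn⟩, ?_, ?_⟩
  · intro ε hε
    obtain ⟨N, hN0, hN⟩ := exists_isSignBilinForm_norm_le 𝕜 hε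
    exact ⟨N, hN0, hN p₁ p₂⟩
  · intro C hC
    refine le_of_forall_pos_le_add fun ε hε => ?_
    obtain ⟨N, -, hN⟩ := hC ε hε
    -- One `n` beyond `N` suffices: the lower bound equals `bennettBound` for every positive `n`, so
    -- dividing by it gives `1 ≤ C + ε`.
    obtain ⟨A, hA, hle⟩ := hN (N + 1) N.lt_succ_self
    have hpos : 0 < bennettBound p₁ p₂ (N + 1) := by
      rw [hB N.succ_pos]
      positivity
    have hlow := hA.rpow_one_sub_recip_max_le_norm h₁ h₂ N.succ_pos
    rw [← hB N.succ_pos] at hlow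
    exact (le_mul_iff_one_le_left hpos).1 (hlow.trans hle)
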